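/- Fix an adiabatic index $\Gamma\in(1,2]$ and units with speed of light $c=1$. For a primitive vector $\mathbf V=(\rho,\mathbf v,\mathbf B,p)$ with $\rho,p\in\mathbb R$ and $\mathbf v,\mathbf B\in\mathbb R^3$, $\rho>0$, $p>0$, $|\mathbf v|<1$, put $W=(1-|\mathbf v|^2)^{-1/2}$, $e=\frac{p}{(\Gamma-1)\rho}$, $h=1+e+\frac p\rho$, $p_{tot}=p+\frac12\big(W^{-2}|\mathbf B|^2+(\mathbf v\cdot\mathbf B)^2\big)$, and define the conservative vector $\mathbf U(\mathbf V)=(D,\mathbf m,\mathbf B,E)\in\mathbb R^8$ by $$D=\rho W,\qquad \mathbf m=\rho hW^2\mathbf v+|\mathbf B|^2\mathbf v-(\mathbf v\cdot\mathbf B)\mathbf B,\qquad E=\rho hW^2-p_{tot}+|\mathbf B|^2 .$$ Let the admissible state set $\mathcal G\subset\mathbb R^8$ of relativistic magnetohydrodynamics be the set of all $\mathbf U(\mathbf V)$ with $\rho>0$, $p>0$, $|\mathbf v|<1$ (on which $\mathbf V$ is uniquely determined by $\mathbf U$), and for $\mathbf U=\mathbf U(\mathbf V)\in\mathcal G$ let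 $$\mathbf F_1(\mathbf U)=\Big(Dv_1,\ v_1\mathbf m-B_1\big(W^{-2}\mathbf B+(\mathbf v\cdot\mathbf B)\mathbf v\big)+p_{tot}\mathbf e_1,\ v_1\mathbf B-B_1\mathbf v,\ m_1\Big)$$ with $\mathbf e_1=(1,0,0)$. **Theorem.** Let $\Delta x>0$, let $(\Delta t_n)_{n\ge0}$ be time steps with the CFL condition $0<\Delta t_n\le\Delta x/c=\Delta x$ for all $n\ge 0$, and let the cell averages $\overline{\mathbf U}{}_j^n\in\mathbb R^8$ ($n\ge0$, $j\in\mathbb Z$) be computed by the first-order Lax–Friedrichs scheme $$\overline{\mathbf U}{}_j^{n+1}=\overline{\mathbf U}{}_j^n-\frac{\Delta t_n}{\Delta x}\Big(\hat{\mathbf F}_1(\overline{\mathbf U}{}_j^n,\overline{\mathbf U}{}_{j+1}^n)-\hat{\mathbf F}_1(\overline{\mathbf U}{}_{j-1}^n,\overline{\mathbf U}{}_j^n)\Big),\qquad \hat{\mathbf F}_1(\mathbf U^-,\mathbf U^+)=\tfrac12\Big(\mathbf F_1(\mathbf U^-)+\mathbf F_1(\mathbf U^+)-(\mathbf U^+-\mathbf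 U^-)\Big).$$ If there is a constant $B_{\rm const}\in\mathbb R$ such that $\overline{\mathbf U}{}_j^0\in\mathcal G$ and $\overline B{}_{1,j}^0=B_{\rm const}$ for all $j$, then $\overline{\mathbf U}{}_j^n\in\mathcal G$ and $\overline B{}_{1,j}^n=B_{\rm const}$ for all $j\in\mathbb Z$ and all $n\ge0$. -/

import Mathlib

noncomputable section

namespace RMHD

/-- Vectors of `ℝ³` with the Euclidean norm; the index `0 : Fin 3` is the `x₁`-direction. -/
abbrev Vec3 : Type := EuclideanSpace ℝ (Fin 3)

/-- Conservative vectors `U = (D, m, B, E)` of `ℝ⁸`, with the componentwise vector space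
structure. -/
abbrev ConsState : Type := ℝ × Vec3 × Vec3 × ℝ

namespace ConsState

/-- The mass density `D`. -/
abbrev D (U : ConsState) : ℝ := U.1

/-- The momentum density `m`. -/
abbrev m (U : ConsState) : Vec3 := U.2.1

/-- The magnetic field `B`. -/
abbrev B (U : ConsState) : Vec3 := U.2.2.1

/-- The energy density `E`. -/
abbrev E (U : ConsState) : ℝ := U.2.2.2

end ConsState

/-- Primitive vectors `V = (ρ, v, B, p)`: rest-mass density, velocity, magnetic field and gas
pressure, in units with speed of light `c = 1`. -/
structure PrimState where
  rho : ℝ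
  v : Vec3
  B : Vec3
  p : ℝ

namespace PrimState

/-- The physical constraints `ρ > 0`, `p > 0`, `|v| < c = 1`. -/
def IsAdmissible (V : PrimState) : Prop := 0 < V.rho ∧ 0 < V.p ∧ ‖V.v‖ < 1

/-- The Lorentz factor `W = 1 / √(1 - |v|²)`. -/
def W (V : PrimState) : ℝ := 1 / √(1 - ‖V.v‖ ^ 2)

/-- The specific internal energy `e`, from the `Γ`-law `p = (Γ - 1) ρ e`. -/
def e (Γ : ℝ) (V : PrimState) : ℝ := V.p / ((Γ - 1) * V.rho)

/-- The specific enthalpy `h = 1 + e + p / ρ`. -/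
def h (Γ : ℝ) (V : PrimState) : ℝ := 1 + V.e Γ + V.p / V.rho

/-- The scalar product `v · B`. -/
def vB (V : PrimState) : ℝ := inner ℝ V.v V.B

/-- The magnetic pressure `p_m = (W⁻² |B|² + (v · B)²) / 2`. -/
def pMag (V : PrimState) : ℝ := (1 / 2) * ((V.W ^ 2)⁻¹ * ‖V.B‖ ^ 2 + V.vB ^ 2)

/-- The total pressure `p_tot = p + p_m`. -/
def pTot (V : PrimState) : ℝ := V.p + V.pMag

/-- The momentum density `m = ρ h W² v + |B|² v - (v · B) B`. -/
def mom (Γ : ℝ) (V : PrimState) : Vec3 :=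
  (V.rho * V.h Γ * V.W ^ 2) • V.v + (‖V.B‖ ^ 2) • V.v - V.vB • V.B

/-- The conservative vector `U(V) = (D, m, B, E)` with `D = ρ W` and
`E = ρ h W² - p_tot + |B|²`. -/
def toCons (Γ : ℝ) (V : PrimState) : ConsState :=
  (V.rho * V.W, V.mom Γ, V.B, V.rho * V.h Γ * V.W ^ 2 - V.pTot + ‖V.B‖ ^ 2)

/-- The flux in the `xᵢ`-direction in terms of the primitive variables,
`(D vᵢ, vᵢ m - Bᵢ (W⁻² B + (v · B) v) + p_tot eᵢ, vᵢ B - Bᵢ v, mᵢ)`. -/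
def flux (Γ : ℝ) (i : Fin 3) (V : PrimState) : ConsState :=
  (V.rho * V.W * V.v i,
   V.v i • V.mom Γ - V.B i • ((V.W ^ 2)⁻¹ • V.B + V.vB • V.v)
     + V.pTot • EuclideanSpace.single i (1 : ℝ),
   V.v i • V.B - V.B i • V.v,
   V.mom Γ i)

end PrimState

/-- The admissible state set `𝒢`: the conservative vectors whose primitive variables satisfy
`ρ > 0`, `p > 0`, `|v| < 1`. -/
def admissibleSet (Γ : ℝ) : Set ConsState :=
  {U | ∃ V : PrimState, V.IsAdmissible ∧ V.toCons Γ = U}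

open Classical in
/-- The primitive vector `V(U)` of an admissible conservative vector `U` (a junk value outside
`𝒢`). It is the only admissible one, see `primOf_toCons` below. -/
def primOf (Γ : ℝ) (U : ConsState) : PrimState :=
  if hU : U ∈ admissibleSet Γ then Classical.choose hU else ⟨0, 0, 0, 0⟩

/-- The flux `Fᵢ(U)` as a function of the conservative vector. -/
def consFlux (Γ : ℝ) (i : Fin 3) (U : ConsState) : ConsState := (primOf Γ U).flux Γ i

/-- The Lax-Friedrichs numerical flux
`F̂ᵢ(U⁻, U⁺) = (Fᵢ(U⁻) + Fᵢ(U⁺) - ϱ (U⁺ - U⁻)) / 2`. -/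
def numFlux (Γ : ℝ) (i : Fin 3) (ϱ : ℝ) (Um Up : ConsState) : ConsState :=
  (1 / 2 : ℝ) • (consFlux Γ i Um + consFlux Γ i Up - ϱ • (Up - Um))

/-- The sequence of cell averages `Ubar n j` (time level `n`, cell `j`) is computed by the
one-dimensional first-order Lax-Friedrichs scheme with numerical viscosity `ϱ₁ = c = 1`, on a
uniform mesh of size `Δx` and with time steps `Δt n`. -/
def IsLxFSolution (Γ Δx : ℝ) (Δt : ℕ → ℝ) (Ubar : ℕ → ℤ → ConsState) : Prop :=
  ∀ (n : ℕ) (j : ℤ), Ubar (n + 1) j = Ubar n j -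
    (Δt n / Δx) • (numFlux Γ 0 1 (Ubar n j) (Ubar n (j + 1))
      - numFlux Γ 0 1 (Ubar n (j - 1)) (Ubar n j))

/-! The primitive variables are well defined: an admissible primitive vector is determined by
its conservative vector. -/

theorem energy_lt {κ b M s D t t' w w' : ℝ} (hκ : 0 ≤ κ) (hκ2 : κ ≤ 1 / 2) (hb : 0 ≤ b)
    (hM : 0 ≤ M) (hs : 0 ≤ s) (hD : 0 ≤ D) (ht : 0 < t) (htt : t < t')
    (hw : w = 1 - M / (t + b) ^ 2 - s * (2 * t + b) / (t ^ 2 * (t + b) ^ 2))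
    (hw' : w' = 1 - M / (t' + b) ^ 2 - s * (2 * t' + b) / (t' ^ 2 * (t' + b) ^ 2))
    (hpos : 0 < w) :
    t - κ * (t * w - D * √w) - (1 / 2) * (b * w + s / t ^ 2) <
      t' - κ * (t' * w' - D * √w') - (1 / 2) * (b * w' + s / t' ^ 2) := by
  have ht' : 0 < t' := ht.trans htt
  have hc : (2 * t' + b) / (t' ^ 2 * (t' + b) ^ 2) ≤ (2 * t + b) / (t ^ 2 * (t + b) ^ 2) := by
    have e2 : ∀ x : ℝ, 0 < x → (2 * x + b) / (x ^ 2 * (x + b) ^ 2)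
        = (1 / x) * (1 / (x + b)) * (1 / x + 1 / (x + b)) := by
      intro x hx
      have : x + b ≠ 0 := by positivity
      field_simp; ring
    rw [e2 t ht, e2 t' ht']
    gcongr
  have hww : w ≤ w' := by
    have h1 : M / (t' + b) ^ 2 ≤ M / (t + b) ^ 2 := by gcongr
    have h2 := mul_le_mul_of_nonneg_left hc hs
    rw [hw, hw', mul_div_assoc, mul_div_assoc]
    linarith
  have hsq : √w ≤ √w' := Real.sqrt_le_sqrt hww
  have htw : t * w ≤ t' * w' := by gcongr
  have id1 : ∀ x y : ℝ, 0 < x → y = 1 - M / (x + b) ^ 2 - s * (2 * x + b) / (x ^ 2 * (x + b) ^ 2) →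
      x - (1 / 2) * (x * y) - (1 / 2) * (b * y + s / x ^ 2)
        = (1 / 2) * (x - b + M / (x + b) + s / (x * (x + b))) := by
    intro x y hx hy
    have : x + b ≠ 0 := by positivity
    rw [hy]; field_simp; ring
  have id2 : (1 / 2) * (t' - b + M / (t' + b) + s / (t' * (t' + b)))
      - (1 / 2) * (t - b + M / (t + b) + s / (t * (t + b)))
      = (1 / 2) * (t' - t) * (1 - M * ((1 / (t + b)) * (1 / (t' + b)))
        - s * ((1 / t) * (1 / (t + b)) * (1 / t' + t * ((1 / t') * (1 / (t' + b)))))) := by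
    have : t + b ≠ 0 := by positivity
    have : t' + b ≠ 0 := by positivity
    field_simp; ring
  have key : 0 < 1 - M * ((1 / (t + b)) * (1 / (t' + b)))
        - s * ((1 / t) * (1 / (t + b)) * (1 / t' + t * ((1 / t') * (1 / (t' + b))))) := by
    have h1 : M * ((1 / (t + b)) * (1 / (t' + b))) ≤ M * ((1 / (t + b)) * (1 / (t + b))) := by
      gcongr
    have h2 : s * ((1 / t) * (1 / (t + b)) * (1 / t' + t * ((1 / t') * (1 / (t' + b)))))
        ≤ s * ((1 / t) * (1 / (t + b)) * (1 / t + t * ((1 / t) * (1 / (t + b))))) := by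
      gcongr
    have h3 : w = 1 - M * ((1 / (t + b)) * (1 / (t + b)))
        - s * ((1 / t) * (1 / (t + b)) * (1 / t + t * ((1 / t) * (1 / (t + b))))) := by
      have : t + b ≠ 0 := by positivity
      rw [hw]; field_simp; ring
    linarith
  have hmain : 0 < (1 / 2) * (t' - t) * (1 - M * ((1 / (t + b)) * (1 / (t' + b)))
        - s * ((1 / t) * (1 / (t + b)) * (1 / t' + t * ((1 / t') * (1 / (t' + b)))))) := by
    have : 0 < t' - t := by linarith
    positivity
  have i1 := id1 t w ht hw
  have i2 := id1 t' w' ht' hw'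
  have f1 : 0 ≤ (1 / 2 - κ) * (t' * w' - t * w) := mul_nonneg (by linarith) (by linarith)
  have f2 : 0 ≤ κ * D * (√w' - √w) := mul_nonneg (by positivity) (by linarith)
  nlinarith

theorem prim_relations {Γ : ℝ} (hΓ : 1 < Γ) {V : PrimState} (hV : V.IsAdmissible) :
    ∃ ξ w : ℝ, 0 < ξ ∧ 0 < w ∧
      w = 1 - ‖(V.toCons Γ).m‖ ^ 2 / (ξ + ‖V.B‖ ^ 2) ^ 2
        - (inner ℝ (V.toCons Γ).m V.B) ^ 2 * (2 * ξ + ‖V.B‖ ^ 2)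
          / (ξ ^ 2 * (ξ + ‖V.B‖ ^ 2) ^ 2) ∧
      0 < (V.toCons Γ).D ∧
      V.rho = (V.toCons Γ).D * √w ∧
      V.p = (Γ - 1) / Γ * (ξ * w - (V.toCons Γ).D * √w) ∧
      (V.toCons Γ).E = ξ - (Γ - 1) / Γ * (ξ * w - (V.toCons Γ).D * √w)
        - (1 / 2) * (‖V.B‖ ^ 2 * w + (inner ℝ (V.toCons Γ).m V.B) ^ 2 / ξ ^ 2) + ‖V.B‖ ^ 2 ∧
      V.v = (1 / (ξ + ‖V.B‖ ^ 2)) •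
        ((V.toCons Γ).m + ((inner ℝ (V.toCons Γ).m V.B) / ξ) • V.B) := by
  obtain ⟨hr, hp, hv⟩ := hV
  have hw : 0 < 1 - ‖V.v‖ ^ 2 := by nlinarith [norm_nonneg V.v]
  have hsw : 0 < √(1 - ‖V.v‖ ^ 2) := Real.sqrt_pos.2 hw
  have hsq : √(1 - ‖V.v‖ ^ 2) ^ 2 = 1 - ‖V.v‖ ^ 2 := Real.sq_sqrt hw.le
  have hW : 0 < V.W := by unfold PrimState.W; positivity
  have hW2 : V.W ^ 2 = 1 / (1 - ‖V.v‖ ^ 2) := by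
    unfold PrimState.W; rw [div_pow, hsq, one_pow]
  have hΓ1 : 0 < Γ - 1 := by linarith
  have hΓ0 : Γ ≠ 0 := by linarith
  have hrh : V.rho * V.h Γ = V.rho + Γ / (Γ - 1) * V.p := by
    unfold PrimState.h PrimState.e
    field_simp; ring
  have hrh0 : 0 < V.rho * V.h Γ := by
    rw [hrh]; have : 0 < Γ / (Γ - 1) := by positivity
    positivity
  have hξ : 0 < V.rho * V.h Γ * V.W ^ 2 := by positivity
  have hξw : V.rho * V.h Γ * V.W ^ 2 * (1 - ‖V.v‖ ^ 2) = V.rho * V.h Γ := by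
    rw [hW2]; field_simp
  have hm : (V.toCons Γ).m = (V.rho * V.h Γ * V.W ^ 2) • V.v + (‖V.B‖ ^ 2) • V.v - V.vB • V.B := rfl
  have hE : (V.toCons Γ).E = V.rho * V.h Γ * V.W ^ 2 - V.pTot + ‖V.B‖ ^ 2 := rfl
  have hD : (V.toCons Γ).D = V.rho * V.W := rfl
  have hDr : V.rho = (V.toCons Γ).D * √(1 - ‖V.v‖ ^ 2) := by
    rw [hD]; unfold PrimState.W; field_simp
  have hD0 : 0 < (V.toCons Γ).D := by rw [hD]; positivity
  generalize (V.toCons Γ).D = D at *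
  generalize (V.toCons Γ).E = E at *
  generalize hmm : (V.toCons Γ).m = m at *
  generalize hξd : V.rho * V.h Γ * V.W ^ 2 = ξ at *
  have hmB : inner ℝ m V.B = ξ * V.vB := by
    rw [hm, inner_sub_left, inner_add_left, inner_smul_left, inner_smul_left, inner_smul_left,
      real_inner_self_eq_norm_sq]
    simp [PrimState.vB]; ring
  have hm2 : ‖m‖ ^ 2 = (ξ + ‖V.B‖ ^ 2) ^ 2 * ‖V.v‖ ^ 2 - (2 * ξ + ‖V.B‖ ^ 2) * V.vB ^ 2 := by
    have hm' : m = (ξ + ‖V.B‖ ^ 2) • V.v - V.vB • V.B := by rw [hm, add_smul]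
    rw [hm', norm_sub_sq_real, norm_smul, norm_smul, inner_smul_left, inner_smul_right,
      mul_pow, mul_pow, Real.norm_eq_abs, Real.norm_eq_abs, sq_abs, sq_abs]
    simp [PrimState.vB]; ring
  have hξb : 0 < ξ + ‖V.B‖ ^ 2 := by positivity
  have hpp : V.p = (Γ - 1) / Γ * (ξ * (1 - ‖V.v‖ ^ 2) - D * √(1 - ‖V.v‖ ^ 2)) := by
    rw [hξw, ← hDr, hrh]; field_simp; ring
  refine ⟨ξ, 1 - ‖V.v‖ ^ 2, hξ, hw, ?_, hD0, hDr, hpp, ?_, ?_⟩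
  · rw [hmB, hm2]; field_simp; ring
  · rw [hE, ← hpp, hmB]; unfold PrimState.pTot PrimState.pMag
    rw [hW2]; field_simp; ring
  · rw [hmB, hm, mul_div_cancel_left₀ _ hξ.ne', sub_add_cancel, ← add_smul, smul_smul,
      one_div, inv_mul_cancel₀ hξb.ne', one_smul]

theorem toCons_injOn {Γ : ℝ} (hΓ : 1 < Γ) (hΓ2 : Γ ≤ 2) {V V' : PrimState}
    (hV : V.IsAdmissible) (hV' : V'.IsAdmissible) (heq : V.toCons Γ = V'.toCons Γ) : V = V' := by
  obtain ⟨t, w, ht, hw, hwe, hD, hr, hp, hE, hv⟩ := prim_relations hΓ hV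
  obtain ⟨t', w', ht', hw', hwe', hD', hr', hp', hE', hv'⟩ := prim_relations hΓ hV'
  have hB : V.B = V'.B := congrArg ConsState.B heq
  rw [← heq, ← hB] at hwe' hE' hv'
  rw [← heq] at hr' hp' hD'
  have hκ : 0 ≤ (Γ - 1) / Γ := div_nonneg (by linarith) (by linarith)
  have hκ2 : (Γ - 1) / Γ ≤ 1 / 2 := by
    rw [div_le_div_iff₀ (by linarith) (by norm_num)]; linarith
  have htt : t = t' := by
    rcases lt_trichotomy t t' with hlt | h0 | hlt
    · have := energy_lt hκ hκ2 (sq_nonneg ‖V.B‖) (sq_nonneg _) (sq_nonneg _) hD.le ht hlt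
        hwe hwe' hw
      linarith
    · exact h0
    · have := energy_lt hκ hκ2 (sq_nonneg ‖V.B‖) (sq_nonneg _) (sq_nonneg _) hD.le ht' hlt
        hwe' hwe hw'
      linarith
  subst htt
  have hww : w = w' := by rw [hwe, hwe']
  subst hww
  cases V; cases V'
  simp only [PrimState.mk.injEq]
  exact ⟨hr.trans hr'.symm, hv.trans hv'.symm, hB, hp.trans hp'.symm⟩

/-- Primitive recovery inverts the map `V ↦ U(V)` on admissible primitive vectors. -/
theorem primOf_toCons {Γ : ℝ} (hΓ : 1 < Γ) (hΓ2 : Γ ≤ 2) {V : PrimState}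
    (hV : V.IsAdmissible) : primOf Γ (V.toCons Γ) = V := by
  have hU : V.toCons Γ ∈ admissibleSet Γ := ⟨V, hV, rfl⟩
  unfold primOf
  rw [dif_pos hU]
  exact toCons_injOn hΓ hΓ2 (Classical.choose_spec hU).1 hV (Classical.choose_spec hU).2

end RMHD

end

/-! Write `r = Δt/Δx`, `P` for `dualPressure x C`. The set `𝒢` is cut out by `D > 0` and, for every
test pair `(x, C)` with `|x| < 1`, the inequality `dualForm x C U + P > 0`
(`mem_admissibleSet_iff`). These constraints are affine in `U`, so convex combinations preserve
them, and the nonlinear recovery of primitive variables drops out of the scheme. In one step the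
flux of the middle cell cancels, leaving `(1 - r) U + (r/2) ((Ul + F(Ul)) + (Ur - F(Ur)))`. For each
`U ± F(U)` the inequality holds only after adding `±(x₁ P - B₁ (x · C))`
(`PrimState.splitting_pos`). These corrections cancel between the two neighbours exactly because
they share `B₁`. The splitting inequality separates into a fluid part, bounded by Cauchy–Schwarz,
and a magnetic part, a sum of squares. Conversely, the affine inequalities give back a primitive
state: one well-chosen test pair puts `E` above the energy of a pressureless state, and the
intermediate value theorem then solves the energy equation with positive pressure. -/

noncomputable section

namespace RMHD

/-! ### Scalar inequalities behind the splitting. -/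

/-- Nonnegativity of the magnetic contribution to the splitting inequality: multiplied by
`2 (1 + θ x₁)` it is a sum of squares. -/
theorem magnetic_form_nonneg {θ v₁ v₂ v₃ B₁ B₂ B₃ x₁ x₂ x₃ C₁ C₂ C₃ : ℝ} (hθ : θ = 1 ∨ θ = -1)
    (hx : x₁ ^ 2 + x₂ ^ 2 + x₃ ^ 2 < 1) {b s pm y pc : ℝ}
    (hb : b = B₁ ^ 2 + B₂ ^ 2 + B₃ ^ 2) (hs : s = v₁ * B₁ + v₂ * B₂ + v₃ * B₃)
    (hpm : pm = 1 / 2 * ((1 - (v₁ ^ 2 + v₂ ^ 2 + v₃ ^ 2)) * b + s ^ 2))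
    (hy : y = x₁ * C₁ + x₂ * C₂ + x₃ * C₃)
    (hpc : pc = 1 / 2 * ((1 - (x₁ ^ 2 + x₂ ^ 2 + x₃ ^ 2)) * (C₁ ^ 2 + C₂ ^ 2 + C₃ ^ 2) + y ^ 2)) :
    0 ≤ (b - pm)
      - ((b * v₁ - s * B₁) * x₁ + (b * v₂ - s * B₂) * x₂ + (b * v₃ - s * B₃) * x₃)
      - (B₁ * ((1 - (x₁ ^ 2 + x₂ ^ 2 + x₃ ^ 2)) * C₁ + y * x₁)
        + B₂ * ((1 - (x₁ ^ 2 + x₂ ^ 2 + x₃ ^ 2)) * C₂ + y * x₂)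
        + B₃ * ((1 - (x₁ ^ 2 + x₂ ^ 2 + x₃ ^ 2)) * C₃ + y * x₃)) + pc
      + θ * ((b * v₁ - s * B₁)
        - (v₁ * ((b * v₁ - s * B₁) * x₁ + (b * v₂ - s * B₂) * x₂ + (b * v₃ - s * B₃) * x₃)
          - B₁ * ((1 - (v₁ ^ 2 + v₂ ^ 2 + v₃ ^ 2)) * (B₁ * x₁ + B₂ * x₂ + B₃ * x₃)
            + s * (v₁ * x₁ + v₂ * x₂ + v₃ * x₃)) + pm * x₁)
        - ((v₁ * B₁ - B₁ * v₁) * ((1 - (x₁ ^ 2 + x₂ ^ 2 + x₃ ^ 2)) * C₁ + y * x₁)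
          + (v₁ * B₂ - B₁ * v₂) * ((1 - (x₁ ^ 2 + x₂ ^ 2 + x₃ ^ 2)) * C₂ + y * x₂)
          + (v₁ * B₃ - B₁ * v₃) * ((1 - (x₁ ^ 2 + x₂ ^ 2 + x₃ ^ 2)) * C₃ + y * x₃))
        + x₁ * pc - B₁ * y) := by
  have hx₁ : |x₁| < 1 := by
    rw [abs_lt]; constructor <;> nlinarith [sq_nonneg x₂, sq_nonneg x₃]
  have ha : 0 < 1 + θ * x₁ := by
    obtain ⟨h1, h2⟩ := abs_lt.1 hx₁
    rcases hθ with rfl | rfl <;> linarith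
  have sos : ∀ z₁ z₂ z₃ d : ℝ, 0 ≤ (1 - (x₁ ^ 2 + x₂ ^ 2 + x₃ ^ 2)) * (z₁ ^ 2 + z₂ ^ 2 + z₃ ^ 2)
      + (x₁ * z₁ + x₂ * z₂ + x₃ * z₃) ^ 2 + d ^ 2 := by
    intro z₁ z₂ z₃ d
    have : 0 < 1 - (x₁ ^ 2 + x₂ ^ 2 + x₃ ^ 2) := by linarith
    positivity
  -- Completing the square in `C` gives the three `z` arguments. The remainder is the square of the
  -- triple product `B · ((v + θ e₁) × (x - v))`.
  have key := sos ((1 + θ * x₁) * C₁ - (1 + θ * v₁) * B₁ + θ * B₁ * (v₁ - x₁))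
    ((1 + θ * x₁) * C₂ - (1 + θ * v₁) * B₂ + θ * B₁ * (v₂ - x₂))
    ((1 + θ * x₁) * C₃ - (1 + θ * v₁) * B₃ + θ * B₁ * (v₃ - x₃))
    (B₁ * ((x₃ - v₃) * v₂ - (x₂ - v₂) * v₃) + B₂ * ((x₁ - v₁) * v₃ - (x₃ - v₃) * (θ + v₁))
      + B₃ * ((x₂ - v₂) * (θ + v₁) - (x₁ - v₁) * v₂))
  refine (mul_nonneg_iff_of_pos_left (mul_pos two_pos ha)).1 (key.trans_eq ?_)
  subst hpm hpc hy hs hb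
  rcases hθ with rfl | rfl <;> ring

/-- Positivity of the hydrodynamic contribution to the splitting inequality. -/
theorem fluid_form_pos {θ v₁ v₂ v₃ x₁ x₂ x₃ ρ p H w q k : ℝ} (hθ : θ = 1 ∨ θ = -1)
    (hρ : 0 < ρ) (hp : 0 < p) (hk : 2 ≤ k) (hw : 0 < w)
    (hv : w ^ 2 = 1 - (v₁ ^ 2 + v₂ ^ 2 + v₃ ^ 2)) (hq : 0 < q)
    (hx : q ^ 2 = 1 - (x₁ ^ 2 + x₂ ^ 2 + x₃ ^ 2)) (hH : H * w ^ 2 = ρ + k * p) :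
    0 < (1 + θ * v₁) * (H * (1 - (v₁ * x₁ + v₂ * x₂ + v₃ * x₃)) - q * (ρ / w))
      - p * (1 + θ * x₁) := by
  have hv₁ : |v₁| < 1 := by
    rw [abs_lt]; constructor <;> nlinarith [sq_nonneg v₂, sq_nonneg v₃]
  have ha : 0 < 1 + θ * v₁ := by
    obtain ⟨h1, h2⟩ := abs_lt.1 hv₁
    rcases hθ with rfl | rfl <;> linarith
  have hvx : w * q ≤ 1 - (v₁ * x₁ + v₂ * x₂ + v₃ * x₃) := by
    nlinarith [sq_nonneg (w - q), sq_nonneg (v₁ - x₁), sq_nonneg (v₂ - x₂), sq_nonneg (v₃ - x₃)]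
  have hvx0 : 0 < 1 - (v₁ * x₁ + v₂ * x₂ + v₃ * x₃) := (mul_pos hw hq).trans_le hvx
  have hθ2 : θ ^ 2 = 1 := by rcases hθ with rfl | rfl <;> norm_num
  have hL : 0 < (v₁ + θ) ^ 2 + v₂ ^ 2 + v₃ ^ 2 := by
    have : 0 < (v₁ + θ) ^ 2 := by
      have : (v₁ + θ) ^ 2 = (1 + θ * v₁) ^ 2 := by linear_combination (1 - v₁ ^ 2) * hθ2
      rw [this]; positivity
    positivity
  -- Right minus left is `L - x · y` with `L = |v + θ e₁|²` and `y = 2 (1 + θ v₁) v + w² θ e₁`.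
  -- Since `|y| = L`, Cauchy–Schwarz and `|x| < 1` suffice.
  have hrefl : w ^ 2 * (1 + θ * x₁)
      < 2 * (1 + θ * v₁) * (1 - (v₁ * x₁ + v₂ * x₂ + v₃ * x₃)) := by
    have hy : (2 * (1 + θ * v₁) * v₁ + w ^ 2 * θ) ^ 2 + (2 * (1 + θ * v₁) * v₂) ^ 2
        + (2 * (1 + θ * v₁) * v₃) ^ 2 = ((v₁ + θ) ^ 2 + v₂ ^ 2 + v₃ ^ 2) ^ 2 := by
      rw [hv]; rcases hθ with rfl | rfl <;> ring
    have hcs : (x₁ * (2 * (1 + θ * v₁) * v₁ + w ^ 2 * θ) + x₂ * (2 * (1 + θ * v₁) * v₂)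
        + x₃ * (2 * (1 + θ * v₁) * v₃)) ^ 2 < ((v₁ + θ) ^ 2 + v₂ ^ 2 + v₃ ^ 2) ^ 2 := by
      have cs : ∀ a b c : ℝ, (x₁ * a + x₂ * b + x₃ * c) ^ 2
          ≤ (x₁ ^ 2 + x₂ ^ 2 + x₃ ^ 2) * (a ^ 2 + b ^ 2 + c ^ 2) := by
        intro a b c
        nlinarith [sq_nonneg (x₁ * b - x₂ * a), sq_nonneg (x₁ * c - x₃ * a),
          sq_nonneg (x₂ * c - x₃ * b)]
      refine (cs _ _ _).trans_lt ?_
      rw [hy]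
      have : x₁ ^ 2 + x₂ ^ 2 + x₃ ^ 2 < 1 := by nlinarith
      exact mul_lt_of_lt_one_left (by positivity) this
    have := (abs_lt_of_sq_lt_sq' hcs hL.le).2
    have e : (v₁ + θ) ^ 2 + v₂ ^ 2 + v₃ ^ 2 = 2 * (1 + θ * v₁) - w ^ 2 := by
      linear_combination hθ2 + hv
    rw [e] at this
    linarith
  have h1 : 0 ≤ (1 + θ * v₁) * ρ * ((1 - (v₁ * x₁ + v₂ * x₂ + v₃ * x₃)) - w * q) :=
    mul_nonneg (by positivity) (by linarith)
  have h2 : 0 < p * (2 * (1 + θ * v₁) * (1 - (v₁ * x₁ + v₂ * x₂ + v₃ * x₃))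
      - w ^ 2 * (1 + θ * x₁)) := mul_pos hp (by linarith)
  have h3 : 0 ≤ (k - 2) * (p * ((1 + θ * v₁) * (1 - (v₁ * x₁ + v₂ * x₂ + v₃ * x₃)))) :=
    mul_nonneg (by linarith) (by positivity)
  refine (mul_pos_iff_of_pos_left (pow_pos hw 2)).1 ?_
  have e : w ^ 2 * ((1 + θ * v₁) * (H * (1 - (v₁ * x₁ + v₂ * x₂ + v₃ * x₃)) - q * (ρ / w))
      - p * (1 + θ * x₁)) = (1 + θ * v₁) * ρ * ((1 - (v₁ * x₁ + v₂ * x₂ + v₃ * x₃)) - w * q)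
      + p * (2 * (1 + θ * v₁) * (1 - (v₁ * x₁ + v₂ * x₂ + v₃ * x₃)) - w ^ 2 * (1 + θ * x₁))
      + (k - 2) * (p * ((1 + θ * v₁) * (1 - (v₁ * x₁ + v₂ * x₂ + v₃ * x₃)))) := by
    have : w ^ 2 * (q * (ρ / w)) = w * q * ρ := by field_simp
    linear_combination (1 + θ * v₁) * (1 - (v₁ * x₁ + v₂ * x₂ + v₃ * x₃)) * hH
      - (1 + θ * v₁) * this
  rw [e]; linarith

/-! ### Affine functionals and the splitting inequality. -/

theorem vec3_norm_sq (x : Vec3) : ‖x‖ ^ 2 = x 0 ^ 2 + x 1 ^ 2 + x 2 ^ 2 := by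
  simp [EuclideanSpace.norm_sq_eq, Fin.sum_univ_three]

theorem vec3_inner (x y : Vec3) : inner ℝ x y = x 0 * y 0 + x 1 * y 1 + x 2 * y 2 := by
  simp [PiLp.inner_apply, Fin.sum_univ_three, mul_comm]

/-- The pairing `U · n*` of a conservative vector with the normal vector `n*` attached to a test
velocity `x` and a test magnetic field `C`. -/
def dualForm (x C : Vec3) : ConsState →ₗ[ℝ] ℝ where
  toFun U := U.E - √(1 - ‖x‖ ^ 2) * U.D - inner ℝ U.m x
    - inner ℝ U.B ((1 - ‖x‖ ^ 2) • C + (inner ℝ x C : ℝ) • x)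
  map_add' U U' := by
    simp only [ConsState.E, ConsState.D, ConsState.m, ConsState.B, Prod.fst_add, Prod.snd_add,
      inner_add_left]
    ring
  map_smul' c U := by
    simp only [ConsState.E, ConsState.D, ConsState.m, ConsState.B, Prod.smul_fst, Prod.smul_snd,
      real_inner_smul_left, smul_eq_mul, RingHom.id_apply]
    ring

/-- The magnetic pressure of a test velocity `x` and a test magnetic field `C`. -/
def dualPressure (x C : Vec3) : ℝ :=
  (1 / 2) * ((1 - ‖x‖ ^ 2) * ‖C‖ ^ 2 + (inner ℝ x C : ℝ) ^ 2)

namespace PrimState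

theorem one_sub_norm_sq_pos {V : PrimState} (hV : V.IsAdmissible) : 0 < 1 - ‖V.v‖ ^ 2 := by
  nlinarith [norm_nonneg V.v, hV.2.2]

theorem inv_W_sq {V : PrimState} (hV : ‖V.v‖ < 1) : (V.W ^ 2)⁻¹ = 1 - ‖V.v‖ ^ 2 := by
  have : 0 ≤ 1 - ‖V.v‖ ^ 2 := by nlinarith [norm_nonneg V.v]
  rw [W, one_div, inv_pow, inv_inv, Real.sq_sqrt this]

theorem enthalpy_eq {Γ : ℝ} (hΓ : 1 < Γ) {V : PrimState} (hρ : V.rho ≠ 0) :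
    V.rho * V.h Γ = V.rho + Γ / (Γ - 1) * V.p := by
  have : Γ - 1 ≠ 0 := by linarith
  unfold h e
  field_simp; ring

/-- The generalized Lax–Friedrichs splitting inequality. -/
theorem splitting_pos {Γ : ℝ} (hΓ1 : 1 < Γ) (hΓ2 : Γ ≤ 2) {V : PrimState} (hV : V.IsAdmissible)
    {x : Vec3} (hx : ‖x‖ < 1) (C : Vec3) {θ : ℝ} (hθ : θ = 1 ∨ θ = -1) :
    0 < dualForm x C (V.toCons Γ + θ • V.flux Γ 0) + dualPressure x C
      + θ * (x 0 * dualPressure x C - V.B 0 * inner ℝ x C) := by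
  have hv := one_sub_norm_sq_pos hV
  have hx' : 0 < 1 - ‖x‖ ^ 2 := by nlinarith [norm_nonneg x]
  have hiW := inv_W_sq hV.2.2
  -- Here `Γ ≤ 2` enters: the factor 2 is what the pressure bound in `fluid_form_pos` consumes.
  have hk : 2 ≤ Γ / (Γ - 1) := by
    rw [le_div_iff₀ (by linarith)]; linarith
  have hH : (V.rho * V.h Γ * V.W ^ 2) * √(1 - ‖V.v‖ ^ 2) ^ 2
      = V.rho + Γ / (Γ - 1) * V.p := by
    rw [Real.sq_sqrt hv.le, ← hiW, ← enthalpy_eq hΓ1 hV.1.ne']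
    have : V.W ≠ 0 := by
      intro h0; rw [h0] at hiW; norm_num at hiW; linarith
    field_simp
  have hD : V.rho * V.W = V.rho / √(1 - ‖V.v‖ ^ 2) := by rw [W, mul_one_div]
  have hf := fluid_form_pos (θ := θ) (v₁ := V.v 0) (v₂ := V.v 1) (v₃ := V.v 2) (x₁ := x 0)
    (x₂ := x 1) (x₃ := x 2) hθ hV.1 hV.2.1 hk (Real.sqrt_pos.2 hv)
    (by rw [Real.sq_sqrt hv.le, vec3_norm_sq]) (Real.sqrt_pos.2 hx')
    (by rw [Real.sq_sqrt hx'.le, vec3_norm_sq]) hH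
  have hm := magnetic_form_nonneg (θ := θ) (v₁ := V.v 0) (v₂ := V.v 1) (v₃ := V.v 2)
    (B₁ := V.B 0) (B₂ := V.B 1) (B₃ := V.B 2) (x₁ := x 0) (x₂ := x 1) (x₃ := x 2)
    (C₁ := C 0) (C₂ := C 1) (C₃ := C 2) (b := ‖V.B‖ ^ 2) (s := V.vB) (pm := V.pMag)
    (y := inner ℝ x C) (pc := dualPressure x C) hθ (by rw [← vec3_norm_sq]; linarith)
    (vec3_norm_sq _) (vec3_inner _ _) (by rw [pMag, hiW, vec3_norm_sq V.v]) (vec3_inner _ _)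
    (by rw [dualPressure, vec3_norm_sq x, vec3_norm_sq C])
  refine (add_pos_of_pos_of_nonneg hf hm).trans_eq ?_
  rw [← hD]
  generalize hq : √(1 - ‖x‖ ^ 2) = q
  simp only [map_add, map_smul, dualForm, toCons, flux, mom, pTot, hiW, LinearMap.coe_mk, hq,
    AddHom.coe_mk, vec3_inner (_ - _), vec3_inner (_ + _), PiLp.add_apply, PiLp.sub_apply,
    PiLp.smul_apply, smul_eq_mul, vec3_inner V.B, PiLp.single_apply, ConsState.E, ConsState.D,
    ConsState.m, ConsState.B, ← vec3_norm_sq]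
  simp
  generalize V.rho * V.h Γ * V.W ^ 2 = H
  ring

end PrimState

/-! ### The scalar equation for `t = ρ h W²`. -/

/-- The squared inverse Lorentz factor in terms of `t = ρ h W²`, with `M = |m|²`, `s = (m · B)²`
and `b = |B|²`. -/
def lorentzFn (M s b t : ℝ) : ℝ :=
  1 - M / (t + b) ^ 2 - s * (2 * t + b) / (t ^ 2 * (t + b) ^ 2)

/-- The energy in terms of `t = ρ h W²`, with `κ = (Γ - 1) / Γ`. -/
def energyFn (κ D M s b t : ℝ) : ℝ :=
  t - κ * (t * lorentzFn M s b t - D * √(lorentzFn M s b t))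
    - (1 / 2) * (b * lorentzFn M s b t + s / t ^ 2) + b

section Recovery

variable {κ D M s b : ℝ}

theorem lorentzFn_mono (hb : 0 ≤ b) (hM : 0 ≤ M) (hs : 0 ≤ s) {t t' : ℝ} (ht : 0 < t)
    (htt : t ≤ t') : lorentzFn M s b t ≤ lorentzFn M s b t' := by
  have ht' : 0 < t' := ht.trans_le htt
  have hc : (2 * t' + b) / (t' ^ 2 * (t' + b) ^ 2) ≤ (2 * t + b) / (t ^ 2 * (t + b) ^ 2) := by
    -- Factored this way, every factor is visibly decreasing in `x`.
    have e2 : ∀ x : ℝ, 0 < x → (2 * x + b) / (x ^ 2 * (x + b) ^ 2)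
        = (1 / x) * (1 / (x + b)) * (1 / x + 1 / (x + b)) := by
      intro x hx
      have : x + b ≠ 0 := by positivity
      field_simp; ring
    rw [e2 t ht, e2 t' ht']
    gcongr
  have h1 : M / (t' + b) ^ 2 ≤ M / (t + b) ^ 2 := by gcongr
  have h2 := mul_le_mul_of_nonneg_left hc hs
  rw [lorentzFn, lorentzFn, mul_div_assoc, mul_div_assoc]
  linarith

theorem lorentzFn_le_one (hb : 0 ≤ b) (hM : 0 ≤ M) (hs : 0 ≤ s) {t : ℝ} (ht : 0 < t) :
    lorentzFn M s b t ≤ 1 := by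
  have h1 : 0 ≤ M / (t + b) ^ 2 := by positivity
  have h2 : 0 ≤ s * (2 * t + b) / (t ^ 2 * (t + b) ^ 2) := by positivity
  rw [lorentzFn]; linarith

theorem continuousOn_lorentzFn (hb : 0 ≤ b) : ContinuousOn (lorentzFn M s b) (Set.Ioi 0) := by
  unfold lorentzFn
  refine ContinuousOn.sub (ContinuousOn.sub continuousOn_const ?_) ?_
  · refine ContinuousOn.div (by fun_prop) (by fun_prop) fun t (ht : 0 < t) => ?_
    positivity
  · refine ContinuousOn.div (by fun_prop) (by fun_prop) fun t (ht : 0 < t) => ?_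
    positivity

/-- Quadratic growth supplies the upper endpoint for the intermediate value theorem. -/
theorem le_sq_mul_lorentzFn (hb : 0 ≤ b) (hM : 0 ≤ M) (hs : 0 ≤ s) {t : ℝ} (ht : 1 ≤ t) :
    t ^ 2 - M - 2 * s ≤ t ^ 2 * lorentzFn M s b t := by
  have ht0 : 0 < t := by linarith
  have h1 : t ^ 2 * (M / (t + b) ^ 2) ≤ M := by
    rw [mul_div_assoc', div_le_iff₀ (by positivity), mul_comm]
    gcongr; linarith
  have h2 : t ^ 2 * (s * (2 * t + b) / (t ^ 2 * (t + b) ^ 2)) ≤ 2 * s := by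
    have : t ^ 2 * (s * (2 * t + b) / (t ^ 2 * (t + b) ^ 2)) = s * (2 * t + b) / (t + b) ^ 2 := by
      have : t + b ≠ 0 := by positivity
      field_simp
    rw [this, div_le_iff₀ (by positivity), mul_comm 2 s, mul_assoc]
    gcongr
    nlinarith
  rw [lorentzFn]; linarith

/-- There is a pressureless primitive state with given density, momentum and magnetic field. -/
theorem exists_sq_mul_lorentzFn_eq (hb : 0 ≤ b) (hM : 0 ≤ M) (hs : 0 ≤ s) (hD : 0 < D) :
    ∃ t, 0 < t ∧ t ^ 2 * lorentzFn M s b t = D ^ 2 := by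
  set T := 1 + D + M + 2 * s with hT
  have hDT : D ≤ T := by linarith
  have hsub : Set.Icc D T ⊆ Set.Ioi 0 := fun t ht => hD.trans_le ht.1
  have hc : ContinuousOn (fun t => t ^ 2 * lorentzFn M s b t) (Set.Icc D T) :=
    ((continuous_pow 2).continuousOn).mul ((continuousOn_lorentzFn hb).mono hsub)
  have hlo : D ^ 2 * lorentzFn M s b D ≤ D ^ 2 :=
    mul_le_of_le_one_right (sq_nonneg D) (lorentzFn_le_one hb hM hs hD)
  have hhi : D ^ 2 ≤ T ^ 2 * lorentzFn M s b T := by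
    refine le_trans ?_ (le_sq_mul_lorentzFn hb hM hs (by linarith))
    nlinarith [mul_nonneg hM hD.le, mul_nonneg hs hD.le, mul_nonneg hM hs]
  obtain ⟨t, ht, h⟩ := intermediate_value_Icc hDT hc ⟨hlo, hhi⟩
  exact ⟨t, hsub ht, h⟩

theorem continuousOn_energyFn (hb : 0 ≤ b) :
    ContinuousOn (energyFn κ D M s b) (Set.Ioi 0) := by
  have hw := continuousOn_lorentzFn (M := M) (s := s) hb
  unfold energyFn
  have h1 : ContinuousOn (fun t : ℝ => s / t ^ 2) (Set.Ioi 0) :=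
    ContinuousOn.div (by fun_prop) (by fun_prop) fun t (ht : 0 < t) => by positivity
  have h2 := hw.sqrt
  fun_prop

/-- The pressure term takes at most half of `t` because `κ ≤ 1/2`, so the energy grows at least
linearly and exceeds any prescribed `E`. -/
theorem le_energyFn (hκ : 0 ≤ κ) (hκ2 : κ ≤ 1 / 2) (hb : 0 ≤ b) (hM : 0 ≤ M) (hs : 0 ≤ s)
    (hD : 0 ≤ D) {t : ℝ} (ht : 1 ≤ t) : t / 2 - s / 2 ≤ energyFn κ D M s b t := by
  have ht0 : 0 < t := by linarith
  have hw1 := lorentzFn_le_one hb hM hs ht0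
  have h1 : s / t ^ 2 ≤ s := div_le_self hs (by nlinarith)
  have h2 : κ * (t * lorentzFn M s b t) ≤ 1 / 2 * t := by
    calc κ * (t * lorentzFn M s b t) ≤ κ * (t * 1) := by gcongr
      _ ≤ 1 / 2 * (t * 1) := by gcongr
      _ = 1 / 2 * t := by ring
  have h3 : 0 ≤ κ * (D * √(lorentzFn M s b t)) := by positivity
  have h4 : b * lorentzFn M s b t ≤ b := mul_le_of_le_one_right hb hw1
  rw [energyFn]; linarith

/-- Solvability of the energy equation above the energy of the pressureless state. -/
theorem exists_energyFn_eq (hκ : 0 ≤ κ) (hκ2 : κ ≤ 1 / 2) (hb : 0 ≤ b) (hM : 0 ≤ M) (hs : 0 ≤ s)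
    (hD : 0 < D) {E t₀ : ℝ} (ht₀ : 0 < t₀) (h₀ : t₀ ^ 2 * lorentzFn M s b t₀ = D ^ 2)
    (hE : energyFn κ D M s b t₀ < E) :
    ∃ t, 0 < t ∧ 0 < lorentzFn M s b t ∧ D * √(lorentzFn M s b t) < t * lorentzFn M s b t ∧
      energyFn κ D M s b t = E := by
  set T := max t₀ (max 1 (2 * E + s)) with hT
  have hTE : 2 * E + s ≤ T := (le_max_right _ _).trans (le_max_right _ _)
  have hT1 : 1 ≤ T := (le_max_left _ _).trans (le_max_right _ _)
  have hsub : Set.Icc t₀ T ⊆ Set.Ioi 0 := fun t ht => ht₀.trans_le ht.1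
  have hhi : E ≤ energyFn κ D M s b T := by
    have := le_energyFn hκ hκ2 hb hM hs hD.le hT1
    linarith
  obtain ⟨t, ht, h⟩ := intermediate_value_Icc (le_max_left _ _)
    ((continuousOn_energyFn hb).mono hsub) ⟨hE.le, hhi⟩
  have ht0 : 0 < t := hsub ht
  have htlt : t₀ < t := lt_of_le_of_ne ht.1 (by rintro rfl; exact hE.ne h)
  have hw₀ : 0 < lorentzFn M s b t₀ :=
    (mul_pos_iff_of_pos_left (pow_pos ht₀ 2)).1 (h₀ ▸ pow_pos hD 2)
  have hmono := lorentzFn_mono hb hM hs ht₀ ht.1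
  have hw : 0 < lorentzFn M s b t := hw₀.trans_le hmono
  refine ⟨t, ht0, hw, ?_, h⟩
  -- Past `t₀`, `t² w` exceeds `D²`, which is positivity of the pressure.
  have hsq : D ^ 2 < (t * √(lorentzFn M s b t)) ^ 2 := by
    rw [← h₀, mul_pow, Real.sq_sqrt hw.le]
    calc t₀ ^ 2 * lorentzFn M s b t₀ < t ^ 2 * lorentzFn M s b t₀ := by gcongr
      _ ≤ t ^ 2 * lorentzFn M s b t := by gcongr
  have hlt : D < t * √(lorentzFn M s b t) := lt_of_pow_lt_pow_left₀ 2 (by positivity) hsq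
  calc D * √(lorentzFn M s b t) < t * √(lorentzFn M s b t) * √(lorentzFn M s b t) := by
        gcongr
    _ = t * lorentzFn M s b t := by rw [mul_assoc, Real.mul_self_sqrt hw.le]

end Recovery

/-! ### The recovered velocity. -/

/-- The velocity recovered from `m`, `B` and `t = ρ h W²`. -/
def velocity (m B : Vec3) (t : ℝ) : Vec3 :=
  (1 / (t + ‖B‖ ^ 2)) • (m + ((inner ℝ m B : ℝ) / t) • B)

section Velocity

variable (m B : Vec3) {t : ℝ}

theorem inner_velocity (ht : 0 < t) : inner ℝ (velocity m B t) B = inner ℝ m B / t := by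
  have : t + ‖B‖ ^ 2 ≠ 0 := by positivity
  rw [velocity, real_inner_smul_left, inner_add_left, real_inner_smul_left,
    real_inner_self_eq_norm_sq]
  field_simp

theorem inner_velocity_self (t : ℝ) : inner ℝ m (velocity m B t)
    = (‖m‖ ^ 2 + (inner ℝ m B : ℝ) ^ 2 / t) / (t + ‖B‖ ^ 2) := by
  rw [velocity, real_inner_smul_right, inner_add_right, real_inner_smul_right,
    real_inner_self_eq_norm_sq]
  ring

theorem one_sub_norm_velocity_sq (ht : 0 < t) : 1 - ‖velocity m B t‖ ^ 2
    = lorentzFn (‖m‖ ^ 2) ((inner ℝ m B : ℝ) ^ 2) (‖B‖ ^ 2) t := by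
  have : t + ‖B‖ ^ 2 ≠ 0 := by positivity
  rw [velocity, norm_smul, mul_pow, norm_add_sq_real, norm_smul, mul_pow,
    real_inner_smul_right, Real.norm_eq_abs, Real.norm_eq_abs, sq_abs, sq_abs, lorentzFn]
  field_simp; ring

theorem add_smul_velocity (ht : 0 < t) :
    t • velocity m B t + ‖B‖ ^ 2 • velocity m B t - ((inner ℝ m B : ℝ) / t) • B = m := by
  have : t + ‖B‖ ^ 2 ≠ 0 := by positivity
  rw [← add_smul, velocity, smul_smul, mul_one_div_cancel this, one_smul, add_sub_cancel_right]

/-- The pairing with `n*` at the recovered velocity and the magnetic field itself measures the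
excess over the energy of the pressureless state. -/
theorem dualForm_velocity {κ D E : ℝ} (hD : 0 < D) (ht : 0 < t)
    (h : t ^ 2 * lorentzFn (‖m‖ ^ 2) ((inner ℝ m B : ℝ) ^ 2) (‖B‖ ^ 2) t = D ^ 2) :
    dualForm (velocity m B t) B (D, m, B, E) + dualPressure (velocity m B t) B
      = E - energyFn κ D (‖m‖ ^ 2) ((inner ℝ m B : ℝ) ^ 2) (‖B‖ ^ 2) t := by
  have hw := one_sub_norm_velocity_sq m B ht
  have hw0 : lorentzFn (‖m‖ ^ 2) ((inner ℝ m B : ℝ) ^ 2) (‖B‖ ^ 2) t = (D / t) ^ 2 := by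
    rw [div_pow, ← h]; field_simp
  -- Eliminating `‖m‖²` leaves a rational identity, as the square root has become `D / t`.
  have hM : ‖m‖ ^ 2 = (t + ‖B‖ ^ 2) ^ 2 * (1 - (D / t) ^ 2
      - (inner ℝ m B : ℝ) ^ 2 * (2 * t + ‖B‖ ^ 2) / (t ^ 2 * (t + ‖B‖ ^ 2) ^ 2)) := by
    have : t + ‖B‖ ^ 2 ≠ 0 := by positivity
    rw [← hw0, lorentzFn]; field_simp; ring
  have hs : √((D / t) ^ 2) = D / t := Real.sqrt_sq (by positivity)
  simp only [dualForm, dualPressure, LinearMap.coe_mk, AddHom.coe_mk, hw, energyFn, hw0, hs,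
    inner_velocity m B ht, inner_velocity_self m B t, inner_add_right, real_inner_smul_right,
    real_inner_self_eq_norm_sq, real_inner_comm (velocity m B t) B]
  rw [hM]
  have : t + ‖B‖ ^ 2 ≠ 0 := by positivity
  field_simp; ring

end Velocity

/-! ### Characterization of `𝒢` by affine inequalities. -/

/-- The first equivalent form of the admissible state set. -/
theorem mem_admissibleSet_iff {Γ : ℝ} (hΓ1 : 1 < Γ) (hΓ2 : Γ ≤ 2) {U : ConsState} :
    U ∈ admissibleSet Γ ↔
      0 < U.D ∧ ∀ x C : Vec3, ‖x‖ < 1 → 0 < dualForm x C U + dualPressure x C := by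
  constructor
  · rintro ⟨V, hV, rfl⟩
    refine ⟨?_, fun x C hx => ?_⟩
    · have := Real.sqrt_pos.2 (PrimState.one_sub_norm_sq_pos hV)
      exact mul_pos hV.1 (one_div_pos.2 this)
    · have h1 := PrimState.splitting_pos hΓ1 hΓ2 hV hx C (Or.inl rfl)
      have h2 := PrimState.splitting_pos hΓ1 hΓ2 hV hx C (Or.inr rfl)
      simp only [map_add, map_smul, smul_eq_mul] at h1 h2
      linarith
  · obtain ⟨D, m, B, E⟩ := U
    rintro ⟨hD : 0 < D, h⟩
    have hb := sq_nonneg ‖B‖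
    have hM := sq_nonneg ‖m‖
    have hs := sq_nonneg (inner ℝ m B : ℝ)
    have hκ : 0 ≤ (Γ - 1) / Γ := div_nonneg (by linarith) (by linarith)
    have hκ2 : (Γ - 1) / Γ ≤ 1 / 2 := by
      rw [div_le_div_iff₀ (by linarith) (by norm_num)]; linarith
    have hlt : ∀ t, 0 < t →
        0 < lorentzFn (‖m‖ ^ 2) ((inner ℝ m B : ℝ) ^ 2) (‖B‖ ^ 2) t → ‖velocity m B t‖ < 1 := by
      intro t ht hw
      rw [← one_sub_norm_velocity_sq m B ht] at hw
      nlinarith [norm_nonneg (velocity m B t)]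
    obtain ⟨t₀, ht₀, h₀⟩ := exists_sq_mul_lorentzFn_eq hb hM hs hD
    -- The converse needs just one test pair: the pressureless velocity and `B` itself.
    have hE : energyFn ((Γ - 1) / Γ) D (‖m‖ ^ 2) ((inner ℝ m B : ℝ) ^ 2) (‖B‖ ^ 2) t₀ < E := by
      have := h (velocity m B t₀) B (hlt t₀ ht₀
        ((mul_pos_iff_of_pos_left (pow_pos ht₀ 2)).1 (h₀ ▸ pow_pos hD 2)))
      rw [dualForm_velocity (κ := (Γ - 1) / Γ) m B hD ht₀ h₀] at this
      linarith
    obtain ⟨t, ht, hw, hp, hEt⟩ := exists_energyFn_eq hκ hκ2 hb hM hs hD ht₀ h₀ hE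
    rw [energyFn] at hEt
    have hv := hlt t ht hw
    rw [← one_sub_norm_velocity_sq m B ht] at hw hp hEt
    generalize hq : √(1 - ‖velocity m B t‖ ^ 2) = q at hp hEt
    have hq0 : 0 < q := hq ▸ Real.sqrt_pos.2 hw
    have hq2 : q ^ 2 = 1 - ‖velocity m B t‖ ^ 2 := hq ▸ Real.sq_sqrt hw.le
    rw [← hq2] at hp hEt
    -- Since `t q²` is to be `ρ h` and `D q` is `ρ`, the identity `ρ h - ρ = Γ p / (Γ - 1)` dictates
    -- the pressure.
    obtain ⟨V, hVd⟩ : ∃ V : PrimState, V =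
      ⟨D * q, velocity m B t, B, (Γ - 1) / Γ * (t * q ^ 2 - D * q)⟩ := ⟨_, rfl⟩
    have hρ : V.rho = D * q := by rw [hVd]
    have hvel : V.v = velocity m B t := by rw [hVd]
    have hB : V.B = B := by rw [hVd]
    have hpr : V.p = (Γ - 1) / Γ * (t * q ^ 2 - D * q) := by rw [hVd]
    have hκ0 : 0 < (Γ - 1) / Γ := div_pos (by linarith) (by linarith)
    have hV : V.IsAdmissible :=
      ⟨hρ ▸ mul_pos hD hq0, hpr ▸ mul_pos hκ0 (by linarith), hvel ▸ hv⟩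
    have hiW : (V.W ^ 2)⁻¹ = q ^ 2 := by rw [PrimState.inv_W_sq hV.2.2, hvel, hq2]
    have hWq : V.W = 1 / q := by rw [PrimState.W, hvel, hq]
    have hH : V.rho * V.h Γ * V.W ^ 2 = t := by
      have h1 : Γ ≠ 0 := by linarith
      have h2 : Γ - 1 ≠ 0 := by linarith
      rw [PrimState.enthalpy_eq hΓ1 hV.1.ne', hρ, hpr, hWq]
      field_simp; ring
    have hvB : V.vB = inner ℝ m B / t := by
      rw [PrimState.vB, hvel, hB, inner_velocity m B ht]
    refine ⟨V, hV, ?_⟩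
    simp only [PrimState.toCons, Prod.mk.injEq]
    refine ⟨?_, ?_, hB, ?_⟩
    · rw [hρ, hWq]; field_simp
    · rw [PrimState.mom, hH, hvel, hB, hvB, add_smul_velocity m B ht]
    · rw [hH, PrimState.pTot, PrimState.pMag, hiW, hvB, hpr, hB, ← hEt, div_pow]
      ring

/-! ### Invariance under one time step. -/

/-- One step of the scheme preserves admissibility, by convexity and the generalized
Lax–Friedrichs splitting. -/
theorem lxf_step_mem {Γ : ℝ} (hΓ1 : 1 < Γ) (hΓ2 : Γ ≤ 2) {r : ℝ} (hr : 0 < r) (hr1 : r ≤ 1)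
    {β : ℝ} {Ul U Ur : ConsState} (hl : Ul ∈ admissibleSet Γ ∧ Ul.B 0 = β)
    (h : U ∈ admissibleSet Γ ∧ U.B 0 = β) (hu : Ur ∈ admissibleSet Γ ∧ Ur.B 0 = β) :
    U - r • (numFlux Γ 0 1 U Ur - numFlux Γ 0 1 Ul U) ∈ admissibleSet Γ ∧
      (U - r • (numFlux Γ 0 1 U Ur - numFlux Γ 0 1 Ul U)).B 0 = β := by
  obtain ⟨hU, hβ⟩ := h
  obtain ⟨⟨Vl, hVl, rfl⟩, hβl⟩ := hl
  obtain ⟨⟨Vr, hVr, rfl⟩, hβr⟩ := hu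
  have hUD := hU
  obtain ⟨V, hV, hVU⟩ := hUD
  have hstep : U - r • (numFlux Γ 0 1 U (Vr.toCons Γ) - numFlux Γ 0 1 (Vl.toCons Γ) U)
      = (1 - r) • U + (r / 2) • ((Vl.toCons Γ + (1 : ℝ) • Vl.flux Γ 0)
        + (Vr.toCons Γ + (-1 : ℝ) • Vr.flux Γ 0)) := by
    simp only [numFlux, consFlux, primOf_toCons hΓ1 hΓ2 hVl, primOf_toCons hΓ1 hΓ2 hVr]
    module
  rw [hstep]
  have hβl' : Vl.B 0 = β := hβl
  have hβr' : Vr.B 0 = β := hβr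
  constructor
  · obtain ⟨hD, hU⟩ := (mem_admissibleSet_iff hΓ1 hΓ2).1 hU
    refine (mem_admissibleSet_iff hΓ1 hΓ2).2 ⟨?_, fun x C hx => ?_⟩
    · have hDpos : ∀ {V : PrimState}, V.IsAdmissible → ∀ θ : ℝ, θ = 1 ∨ θ = -1 →
          0 < V.rho * V.W + θ * (V.rho * V.W * V.v 0) := by
        intro V hV θ hθ
        have hW : 0 < V.rho * V.W := mul_pos hV.1
          (one_div_pos.2 (Real.sqrt_pos.2 (PrimState.one_sub_norm_sq_pos hV)))
        obtain ⟨h1, h2⟩ := abs_lt.1 ((PiLp.norm_apply_le V.v 0).trans_lt hV.2.2)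
        rcases hθ with rfl | rfl <;> nlinarith
      have h1 := hDpos hVl 1 (Or.inl rfl)
      have h2 := hDpos hVr (-1) (Or.inr rfl)
      have h3 : 0 ≤ (1 - r) * U.D := mul_nonneg (by linarith) hD.le
      have h4 := mul_pos (half_pos hr) (add_pos h1 h2)
      have h5 := add_pos_of_nonneg_of_pos h3 h4
      exact h5
    · have h1 := PrimState.splitting_pos hΓ1 hΓ2 hVl hx C (Or.inl rfl)
      have h2 := PrimState.splitting_pos hΓ1 hΓ2 hVr hx C (Or.inr rfl)
      have h3 : 0 ≤ (1 - r) * (dualForm x C U + dualPressure x C) :=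
        mul_nonneg (by linarith) (hU x C hx).le
      have h4 := mul_pos (half_pos hr) (add_pos h1 h2)
      -- With equal `B₁` the two corrections, of opposite sign, cancel.
      rw [hβl', hβr'] at h4
      rw [map_add, map_smul, map_smul, map_add (dualForm x C) (_ + _), smul_eq_mul, smul_eq_mul]
      linarith
  -- The `B₁` component of the flux vanishes identically.
  · have hflux : ∀ V : PrimState, (V.v 0 • V.B - V.B 0 • V.v) 0 = 0 := by
      intro V
      simp [mul_comm]
    have e : ((1 - r) • U + (r / 2) • ((Vl.toCons Γ + (1 : ℝ) • Vl.flux Γ 0)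
        + (Vr.toCons Γ + (-1 : ℝ) • Vr.flux Γ 0))).B 0
        = (1 - r) * U.B 0 + (r / 2) * ((Vl.B 0 + 1 * (Vl.v 0 • Vl.B - Vl.B 0 • Vl.v) 0)
          + (Vr.B 0 + -1 * (Vr.v 0 • Vr.B - Vr.B 0 • Vr.v) 0)) := rfl
    rw [e, hflux, hflux, hβ, hβl', hβr']
    ring

end RMHD
end

theorem theorem3p1 (Γ : ℝ) (hΓ1 : 1 < Γ) (hΓ2 : Γ ≤ 2)
    (Δx : ℝ) (Δt : ℕ → ℝ) (hCFL : ∀ n : ℕ, 0 < Δt n ∧ Δt n ≤ Δx)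
    (Bconst : ℝ) (Ubar : ℕ → ℤ → RMHD.ConsState)
    (hinit : ∀ j : ℤ, Ubar 0 j ∈ RMHD.admissibleSet Γ ∧ (Ubar 0 j).B 0 = Bconst)
    (hscheme : RMHD.IsLxFSolution Γ Δx Δt Ubar) :
    ∀ (n : ℕ) (j : ℤ),
      Ubar n j ∈ RMHD.admissibleSet Γ ∧ (Ubar n j).B 0 = Bconst := by
  intro n
  induction n with
  | zero => exact hinit
  | succ n ih =>
    intro j
    obtain ⟨h0, h1⟩ := hCFL n
    have hx : 0 < Δx := h0.trans_le h1
    rw [hscheme n j]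
    exact RMHD.lxf_step_mem hΓ1 hΓ2 (div_pos h0 hx) ((div_le_one hx).2 h1)
      (ih (j - 1)) (ih j) (ih (j + 1))
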